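/- Let $R$ be a commutative ring with identity. An ideal of $R$ is called \emph{regular} if it contains a non-zero-divisor, and \emph{semi-regular} if it contains a finitely generated ideal $I_0$ with $(0:_R I_0)=0$. The ring $R$ is a \emph{Prüfer ring} (respectively, a \emph{strong Prüfer ring}) if every finitely generated regular (respectively, finitely generated semi-regular) ideal of $R$ is projective. A finitely generated ideal $J$ of $R$ is a \emph{GV-ideal} if $\operatorname{Hom}_R(R/J,R)=0$ and $\operatorname{Ext}^1_R(R/J,R)=0$, and $R$ is a \emph{DW-ring} if the only GV-ideal of $R$ is $R$ itself, that is, $\mathrm{GV}(R)=\{R\}$. Every strong Prüfer ring is both a Prüfer ring and a DW-ring. -/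

import Mathlib

universe u

/-- An ideal is *regular* if it contains a regular element, i.e. a non-zero-divisor of `R`. -/
def Ideal.IsRegularIdeal {R : Type u} [CommRing R] (I : Ideal R) : Prop :=
  ∃ a ∈ I, a ∈ nonZeroDivisors R

/-- An ideal is *semi-regular* if it contains a finitely generated ideal `I₀` that is dense, i.e.
`(0 :_R I₀) = 0`. For a finitely generated ideal `I` this says `(0 :_R I) = 0`, see
`Ideal.isSemiRegular_iff_of_fg`. -/
def Ideal.IsSemiRegular {R : Type u} [CommRing R] (I : Ideal R) : Prop :=
  ∃ I₀ : Ideal R, I₀ ≤ I ∧ I₀.FG ∧ ∀ r : R, (∀ x ∈ I₀, r * x = 0) → r = 0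

theorem Ideal.isSemiRegular_iff_of_fg {R : Type u} [CommRing R] {I : Ideal R} (hI : I.FG) :
    I.IsSemiRegular ↔ ∀ r : R, (∀ x ∈ I, r * x = 0) → r = 0 :=
  ⟨fun ⟨_, hle, _, h⟩ r hr => h r fun x hx => hr x (hle hx), fun h => ⟨I, le_rfl, hI, h⟩⟩

/-- A commutative ring is a *Prüfer ring* if every finitely generated regular ideal is
projective. -/
def IsPruferRing (R : Type u) [CommRing R] : Prop :=
  ∀ I : Ideal R, I.FG → I.IsRegularIdeal → Module.Projective R I

/-- A commutative ring is a *strong Prüfer ring* if every finitely generated semi-regular ideal is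
projective. -/
def IsStrongPruferRing (R : Type u) [CommRing R] : Prop :=
  ∀ I : Ideal R, I.FG → I.IsSemiRegular → Module.Projective R I

/-- A *GV-ideal* (Glaz–Vasconcelos ideal) is a finitely generated ideal `J` such that
`Hom_R(R/J, R) = 0` and `Ext_R^1(R/J, R) = 0`. -/
def Ideal.IsGV {R : Type u} [CommRing R] (J : Ideal R) : Prop :=
  J.FG ∧ Subsingleton ((R ⧸ J) →ₗ[R] R) ∧
    Subsingleton (CategoryTheory.Abelian.Ext (ModuleCat.of R (R ⧸ J)) (ModuleCat.of R R) 1)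

/-- The set `GV(R)` of all GV-ideals of `R`. -/
def GVIdeals (R : Type u) [CommRing R] : Set (Ideal R) :=
  {J | J.IsGV}

/-- A commutative ring is a *DW-ring* if `GV(R) = {R}`. -/
def IsDWRing (R : Type u) [CommRing R] : Prop :=
  GVIdeals R = {⊤}

/-! A non-zero-divisor generates a dense ideal, so regular ideals are semi-regular. A GV-ideal `J`
is dense because `Hom(R/J, R) = 0`, hence projective. Split `p : Rⁿ → J` by `s`; since `Ext¹(R/J, R)
= 0`, each coordinate of `s` is multiplication by some `rᵢ`. Thus `x = p (s x) = x * p r` on `J`,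
and density forces `1 = p r ∈ J`. -/

open CategoryTheory CategoryTheory.Abelian in
/-- If `Ext¹(R/J, M) = 0`, every linear map `J → M` extends to `R`. -/
theorem Ideal.exists_extend_of_subsingleton_ext {R : Type u} [CommRing R] (J : Ideal R)
    (M : Type u) [AddCommGroup M] [Module R M]
    [Subsingleton (Ext (ModuleCat.of R (R ⧸ J)) (ModuleCat.of R M) 1)] (f : J →ₗ[R] M) :
    ∃ g : R →ₗ[R] M, ∀ x : J, g x = f x := by
  let S : ShortComplex (ModuleCat.{u} R) :=
    ShortComplex.mk (X₁ := ModuleCat.of R J) (X₂ := ModuleCat.of R R)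
      (X₃ := ModuleCat.of R (R ⧸ J)) (ModuleCat.ofHom J.subtype) (ModuleCat.ofHom J.mkQ) (by
        ext x
        exact Ideal.Quotient.eq_zero_iff_mem.mpr x.2)
  have hS : S.ShortExact := ModuleCat.shortComplex_shortExact S
    (LinearMap.exact_subtype_mkQ J) J.injective_subtype J.mkQ_surjective
  have : Subsingleton (Ext S.X₃ (ModuleCat.of R M) 1) :=
    inferInstanceAs (Subsingleton (Ext (ModuleCat.of R (R ⧸ J)) (ModuleCat.of R M) 1))
  -- The connecting map sends `f` into `Ext¹(R/J, M) = 0`, so `f` is a restriction from `R`.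
  obtain ⟨y, hy⟩ := Ext.contravariant_sequence_exact₁ hS (ModuleCat.of R M)
    (Ext.mk₀ (ModuleCat.ofHom f : S.X₁ ⟶ ModuleCat.of R M)) (add_zero 1)
    (Subsingleton.elim _ _)
  obtain ⟨g, rfl⟩ := Ext.homEquiv₀.symm.surjective y
  have hg : S.f ≫ g = ModuleCat.ofHom f := by
    apply Ext.homEquiv₀.symm.injective
    change Ext.mk₀ _ = Ext.mk₀ _
    rw [← hy, ← Ext.mk₀_comp_mk₀]
    rfl
  exact ⟨g.hom, fun x => congrArg (fun h : S.X₁ ⟶ ModuleCat.of R M => h.hom x) hg⟩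

/-- The annihilator of an ideal `J` with `Hom(R/J, R) = 0` is zero. -/
theorem Ideal.eq_zero_of_subsingleton_hom {R : Type u} [CommRing R] (J : Ideal R)
    [Subsingleton ((R ⧸ J) →ₗ[R] R)] (r : R) (hr : ∀ x ∈ J, r * x = 0) : r = 0 := by
  have h := DFunLike.congr_fun (Subsingleton.elim
    (J.liftQ (LinearMap.mulLeft R r) fun x hx => LinearMap.mem_ker.mpr (hr x hx)) 0)
    (Ideal.Quotient.mk J 1)
  have h' : r * 1 = 0 := h
  rwa [mul_one] at h'

/-- A projective GV-ideal is the unit ideal. -/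
theorem Ideal.IsGV.eq_top_of_projective {R : Type u} [CommRing R] {J : Ideal R} (hJ : J.IsGV)
    [Module.Projective R J] : J = ⊤ := by
  obtain ⟨hfg, hHom, hExt⟩ := hJ
  have : Module.Finite R J := Module.Finite.iff_fg.mpr hfg
  obtain ⟨n, p, s, -, -, hps⟩ := Module.Finite.exists_comp_eq_id_of_projective R J
  have key (i : Fin n) : ∃ r : R, ∀ x : J, s x i = r * x := by
    obtain ⟨g, hg⟩ := J.exists_extend_of_subsingleton_ext R (LinearMap.proj i ∘ₗ s)
    refine ⟨g 1, fun x => ?_⟩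
    have h := g.map_smul (x : R) 1
    rw [smul_eq_mul, mul_one, hg, smul_eq_mul, mul_comm] at h
    exact h
  choose r hr using key
  have hmem : ((p r : J) : R) = 1 := by
    rw [eq_comm, ← sub_eq_zero]
    -- By density, it suffices that `1 - p r` kills `J`.
    refine J.eq_zero_of_subsingleton_hom _ fun x hx => ?_
    have hs : s ⟨x, hx⟩ = x • r := by
      ext i
      rw [hr, Pi.smul_apply, smul_eq_mul, mul_comm]
    have h : ((p (s ⟨x, hx⟩) : J) : R) = x :=
      congrArg Subtype.val (DFunLike.congr_fun hps (⟨x, hx⟩ : J))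
    rw [hs, map_smul, Submodule.coe_smul, smul_eq_mul] at h
    rw [sub_mul, one_mul, mul_comm, h, sub_self]
  exact J.eq_top_iff_one.mpr (hmem ▸ (p r).2)

theorem Ideal.isGV_top (R : Type u) [CommRing R] : (⊤ : Ideal R).IsGV := by
  have : Subsingleton (R ⧸ (⊤ : Ideal R)) := Ideal.Quotient.subsingleton_iff.mpr rfl
  refine ⟨⟨{1}, by simp⟩, inferInstance, ⟨fun a b => ?_⟩⟩
  have : CategoryTheory.Projective (ModuleCat.of R (R ⧸ (⊤ : Ideal R))) :=
    (ModuleCat.isZero_of_subsingleton _).projective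
  rw [a.eq_zero_of_projective, b.eq_zero_of_projective]

theorem Ideal.IsRegularIdeal.isSemiRegular {R : Type u} [CommRing R] {I : Ideal R}
    (hI : I.IsRegularIdeal) : I.IsSemiRegular := by
  obtain ⟨a, haI, ha⟩ := hI
  exact ⟨Ideal.span {a}, (Ideal.span_singleton_le_iff_mem I).mpr haI, ⟨{a}, by simp⟩,
    fun r hr => (mul_right_mem_nonZeroDivisors_eq_zero_iff ha).mp
      (hr a (Ideal.mem_span_singleton_self a))⟩

theorem mainTheorem10 (R : Type u) [CommRing R] (hR : IsStrongPruferRing R) :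
    IsPruferRing R ∧ IsDWRing R := by
  refine ⟨fun I hfg hI => hR I hfg hI.isSemiRegular, Set.eq_singleton_iff_unique_mem.mpr
    ⟨Ideal.isGV_top R, fun J (hJ : J.IsGV) => ?_⟩⟩
  have := hJ.2.1
  have := hR J hJ.1 ((Ideal.isSemiRegular_iff_of_fg hJ.1).mpr J.eq_zero_of_subsingleton_hom)
  exact hJ.eq_top_of_projective
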